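/- Let $V$ be a finite-dimensional vector space over a field $\mathbb{K}$, let $H_1,\dots,H_t$ be finitely many hyperplanes (linear subspaces of codimension one) of $V$ with $\bigcap_i H_i=0$, and let $\mathcal{H}$ be the essential hyperplane arrangement they generate, i.e. the set of all intersections of the $H_i$ (including the empty intersection $V$), ordered by inclusion. Let $r$ be its rank, the codimension of $\bigcap_i H_i$ (so $r=\dim V$). *Coordinate arrangements.* A coordinate arrangement $\mathcal{F}$ indexed by $\mathcal{H}$ is a finite-dimensional vector space $F$ with subspaces $F^X\subseteq F$ $(X\in\mathcal{H})$, all spanned by subsets of one common basis of $F$ (an adapted basis), such that $F^V=F$ and $F^{X\cap Y}=F^X\cap F^Y$. *Resolutions.* A resolution of $\mathcal{H}$ by coordinate arrangements is a sequence of linear maps $\cdots\to F_1\xrightarrow{\phi_1}F_0\xrightarrow{\phi_0}V$, where each $F_i$ carries a coordinate arrangement $\mathcal{F}_i$ indexed by $\mathcal{H}$, such that, with $X^0:=X$ and $X^{i+1}:=\ker(\phi_i|_{F_i^X})$, one has $\phi_i(F_i^X)=X^i$; that is, there are short exact sequences $0\to X^{i+1}\to F_i^X\xrightarrow{\phi_i}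 X^i\to 0$ for all $X\in\mathcal{H}$ and $i\ge 0$. It is minimal if for $i\geq 1$ the matrix of $\phi_i$ with respect to any adapted bases has no nonzero entry between a basis vector $b$ of $F_i$ and a basis vector $c$ of $F_{i-1}$ of the same degree, i.e. such that $b\in F_i^X\Leftrightarrow c\in F_{i-1}^X$ for all $X\in\mathcal{H}$ (equivalently, no common summand can be split off from $\mathcal{F}_i$ and $\mathcal{F}_{i-1}$). *Beta invariants.* For $X\in\mathcal{H}$ and $k\ge 0$ let $\mathcal{P}_{k,X}=\{Y\in\mathcal{H}\mid Y\le X,\ \dim Y\le k\}\cup\{X\}$ with Möbius function $\mu^{k,X}$, and set $$\beta^{k,X}=(-1)^k\sum_{d=0}^{\dim X} d\, w^{k,X}_{d,\dim X},\qquad w^{k,X}_{ij}=\sum_{\substack{Y\le Z\text{ in }\mathcal{P}_{k,X}\\ \dim Y=i,\ \dim Z=j}}\mu^{k,X}(Y,Z),$$ and, for $X\ne 0$, $\beta^X=\beta^{\dim X-1,X}$. **Theorem.** There exists a minimal resolution $$0\to\mathcal{F}_{r-1}\to\cdots\to\mathcal{F}_0\to\mathcal{H}\to 0$$ of $\mathcal{H}$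 by coordinate arrangements (so $F_i=0$ for $i\ge r$) with the following properties. 1. For all $i\ge 0$ and $Y\in\mathcal{H}$, $$F_i^Y=\bigoplus_{\substack{X\le Y\\ \dim X=i+1}}F_i^X .$$ 2. For every $X\in\mathcal{H}$ with $\dim X=i+1$, the map $\phi_i$ restricts to an isomorphism $F_i^X\cong X^i$ (so that, by 1, the differential is the sum of these isomorphisms). 3. For every $X\in\mathcal{H}$, $\dim X^k=\beta^{k,X}$ for $0\le k<\dim X$, and $X^k=0$ for $k\ge\dim X$. In particular $\dim X^i=\dim F_i^X=\beta^X$ if $\dim X=i+1$. -/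

import Mathlib

universe u v

namespace HyperplaneResolution

section Arrangement

variable {K : Type u} [Field K] {V : Type v} [AddCommGroup V] [Module K V]

/-- A finite (central) hyperplane arrangement in `V`, given by its generating hyperplanes,
i.e. maximal proper linear subspaces. -/
def IsHyperplaneArrangement (A : Finset (Submodule K V)) : Prop :=
  ∀ H ∈ A, IsCoatom H

/-- The intersection of all hyperplanes of the arrangement (`⊤` if there are none). -/
def center (A : Finset (Submodule K V)) : Submodule K V :=
  A.inf id

/-- An arrangement is essential if its hyperplanes intersect in `0` only. -/
def IsEssential (A : Finset (Submodule K V)) : Prop :=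
  center A = ⊥

/-- The rank of an arrangement: the codimension of the intersection of its hyperplanes. -/
noncomputable def arrangementRank (A : Finset (Submodule K V)) : ℕ :=
  Module.finrank K (V ⧸ center A)

open scoped Classical in
/-- The intersection poset: all intersections of hyperplanes of the arrangement, including
the empty intersection `V`.  It is ordered by inclusion of subspaces. -/
noncomputable def intersectionPoset (A : Finset (Submodule K V)) : Finset (Submodule K V) :=
  A.powerset.image fun S => S.inf id

/-! ### Beta invariants -/

open scoped Classical in
/-- The Möbius function of the finite set `P` of subspaces, ordered by inclusion. -/
noncomputable def mobius (P : Finset (Submodule K V)) (X Y : P) : ℤ :=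
  letI : LocallyFiniteOrder P := Fintype.toLocallyFiniteOrder
  IncidenceAlgebra.mu ℤ X Y

open scoped Classical in
/-- The Whitney number `w_{ij}`: the sum of all `μ(X, Y)` with `X ≤ Y` in `P`,
`dim X = i` and `dim Y = j`. -/
noncomputable def whitneyNumber (P : Finset (Submodule K V)) (i j : ℕ) : ℤ :=
  ∑ X : P, ∑ Y : P,
    if X ≤ Y ∧ Module.finrank K X.1 = i ∧ Module.finrank K Y.1 = j then mobius P X Y else 0

open scoped Classical in
/-- The poset `{Y ≤ X | dim Y ≤ k} ∪ {X}`, for an element `X` of the intersection poset. -/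
noncomputable def truncatedPoset (A : Finset (Submodule K V)) (k : ℕ)
    (X : intersectionPoset A) : Finset (Submodule K V) :=
  {Y ∈ intersectionPoset A | Y ≤ X.1 ∧ (Module.finrank K Y ≤ k ∨ Y = X.1)}

/-- The beta invariant `β^{k,X}` of the truncated poset `{Y ≤ X | dim Y ≤ k} ∪ {X}`. -/
noncomputable def betaTrunc (A : Finset (Submodule K V)) (k : ℕ) (X : intersectionPoset A) : ℤ :=
  (-1) ^ k * ∑ d ∈ Finset.range (Module.finrank K X.1 + 1),
    (d : ℤ) * whitneyNumber (truncatedPoset A k X) d (Module.finrank K X.1)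

/-- The beta invariant `β^X = β^{dim X - 1, X}` (used for `X ≠ 0` only). -/
noncomputable def betaInvariant (A : Finset (Submodule K V)) (X : intersectionPoset A) : ℤ :=
  betaTrunc A (Module.finrank K X.1 - 1) X

/-! ### Coordinate arrangements -/

variable {M : Type v} [AddCommGroup M] [Module K M]

/-- A basis of `M` is adapted to a family of subspaces if each member of the family is
spanned by a subset of the basis. -/
def IsAdaptedBasis {A : Finset (Submodule K V)} (fil : intersectionPoset A → Submodule K M)
    {n : ℕ} (b : Module.Basis (Fin n) K M) : Prop :=
  ∀ X, ∃ S : Set (Fin n), fil X = Submodule.span K (b '' S)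

/-- A coordinate arrangement indexed by the intersection poset of `A`: a family of coordinate
subspaces, with respect to one finite basis of the ambient space, which is compatible with
intersections and takes the value of the whole space at `V`. -/
structure IsCoordinateArrangement {A : Finset (Submodule K V)}
    (fil : intersectionPoset A → Submodule K M) : Prop where
  exists_basis : ∃ (n : ℕ) (b : Module.Basis (Fin n) K M), IsAdaptedBasis fil b
  top : ∀ X : intersectionPoset A, X.1 = ⊤ → fil X = ⊤
  inter : ∀ X Y Z : intersectionPoset A, Z.1 = X.1 ⊓ Y.1 → fil Z = fil X ⊓ fil Y

end Arrangement

/-! ### Resolutions by coordinate arrangements -/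

section Resolution

variable {K : Type u} [Field K] {V : Type v} [AddCommGroup V] [Module K V]

variable (V) in
/-- The sequence of vector spaces `V, F 0, F 1, F 2, …`. -/
def augTerm (F : ℕ → ModuleCat.{v} K) : ℕ → ModuleCat.{v} K
  | 0 => ModuleCat.of K V
  | i + 1 => F i

/-- A sequence `⋯ → F 1 → F 0 → V` of vector spaces and linear maps, where each `F i` carries
a family of subspaces `F i ^ X` indexed by the intersection poset of `A`.
The map `φ 0` goes from `F 0` to `V`, and `φ (i + 1)` goes from `F (i + 1)` to `F i`. -/
structure ArrangementSequence (A : Finset (Submodule K V)) where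
  /-- the vector spaces -/
  F : ℕ → ModuleCat.{v} K
  /-- the subspaces `F i ^ X` -/
  fil : ∀ i, intersectionPoset A → Submodule K (F i)
  /-- the differentials -/
  φ : ∀ i, F i →ₗ[K] augTerm V F i

namespace ArrangementSequence

variable {A : Finset (Submodule K V)} (R : ArrangementSequence A)

/-- The space `X^i` representing `X` in the `i`-th syzygy: `X^0 = X ⊆ V`, and `X^(i+1)` is the
kernel of `φ i` on `F i ^ X`. -/
def syz : ∀ i, intersectionPoset A → Submodule K (augTerm V R.F i)
  | 0, X => X.1
  | i + 1, X => (R.fil i X ⊓ LinearMap.ker (R.φ i) : Submodule K (R.F i))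

/-- The sequence is a resolution of the arrangement by coordinate arrangements: for each `X`,
`φ i` induces short exact sequences `0 → X^(i+1) → F i ^ X → X^i → 0`. -/
structure IsResolution : Prop where
  coordinate : ∀ i, IsCoordinateArrangement (R.fil i)
  exact : ∀ i X, (R.fil i X).map (R.φ i) = R.syz i X

/-- Minimality: no differential `F (i + 1) → F i` has, with respect to any adapted bases, a
nonzero matrix entry between two basis vectors of the same degree, i.e. no summand can be split
off from `F (i + 1)` and `F i`.  Two basis vectors have the same degree if they lie in the
subspaces belonging to the same `X`. -/
def IsMinimal : Prop :=
  ∀ (i m n : ℕ) (b : Module.Basis (Fin m) K (R.F (i + 1))) (c : Module.Basis (Fin n) K (R.F i)),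
    IsAdaptedBasis (R.fil (i + 1)) b → IsAdaptedBasis (R.fil i) c →
    ∀ (j : Fin m) (l : Fin n),
      (∀ X, b j ∈ R.fil (i + 1) X ↔ c l ∈ R.fil i X) →
      c.repr (R.φ (i + 1) (b j) : R.F i) l = 0

end ArrangementSequence

end Resolution

end HyperplaneResolution

/-! The resolution is forced: `F i` must be the direct sum of the syzygy spaces `X^i` with `dim X =
i + 1`, mapped to the previous term by the inclusions. The content is exactness, that `F i ^ X →
X^i` is onto for every `X`.

Exactness rests on `syz_inf_iSup_le`: a syzygy of `X` supported on the sections by hyperplanes of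
`B` is a sum of syzygies of these sections, if `B` is irredundant on `X`, or meets `X` only in `0`
and `dim X ≥ i + 2`. In degree `i` this law gives surjectivity, by induction on `dim X`. With
surjectivity, `syz_succ_inf_iSup_le` lifts the law to degree `i + 1`, using that the coordinate
subspaces `F i ^ X` form a distributive family. Plain linear algebra of hyperplane sections in `V`
starts the induction.

Minimality is a degree argument: `F (i + 1) ^ X = 0` if `dim X = i + 1`. The dimensions come from
rank-nullity, which telescopes to `finrank_syz`, and Möbius inversion on the truncated poset. -/

namespace HyperplaneResolution

/-! ### Independent families and hyperplane sections of a subspace. -/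

section Lattice

/-- Suprema over subfamilies of an independent family are compatible with intersections. -/
theorem biSup_inf_biSup_of_iSupIndep {ι : Type*} {α : Type*} [CompleteLattice α]
    [IsModularLattice α] [IsCompactlyGenerated α] {t : ι → α} (ht : iSupIndep t) (S T : Set ι) :
    (⨆ i ∈ S, t i) ⊓ (⨆ i ∈ T, t i) = ⨆ i ∈ S ∩ T, t i := by
  have h1 : (⨆ i ∈ S, t i) = (⨆ i ∈ S ∩ T, t i) ⊔ (⨆ i ∈ S \ T, t i) := by
    rw [← iSup_union, Set.inter_union_sdiff]
  have h2 : (⨆ i ∈ S ∩ T, t i) ≤ ⨆ i ∈ T, t i := biSup_mono fun _ h => h.2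
  have h3 : Disjoint (⨆ i ∈ S \ T, t i) (⨆ i ∈ T, t i) :=
    ht.disjoint_biSup_biSup Set.disjoint_sdiff_left
  rw [h1, sup_inf_assoc_of_le _ h2, h3.eq_bot, sup_bot_eq]

theorem finrank_biSup_of_iSupIndep {K M ι : Type*} [Field K] [AddCommGroup M] [Module K M]
    [FiniteDimensional K M] {t : ι → Submodule K M} (ht : iSupIndep t) (s : Finset ι) :
    Module.finrank K ↥(⨆ i ∈ s, t i) = ∑ i ∈ s, Module.finrank K (t i) := by
  classical
  induction s using Finset.induction_on with
  | empty => simp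
  | insert a s ha ih =>
    have hd : Disjoint (t a) (⨆ i ∈ s, t i) := ht.disjoint_biSup (y := (s : Set ι)) (by simpa)
    have h := Submodule.finrank_sup_add_finrank_inf_eq (t a) (⨆ i ∈ s, t i)
    rw [hd.eq_bot, finrank_bot, add_zero, ih] at h
    rw [Finset.iSup_insert, h, Finset.sum_insert ha]

variable {K V : Type*} [Field K] [AddCommGroup V] [Module K V]

/-- The intersection of `X` with a coatom not containing `X` has codimension one in `X`. -/
theorem finrank_inf_coatom [FiniteDimensional K V] {X H : Submodule K V} (hH : IsCoatom H)
    (hX : ¬ X ≤ H) : Module.finrank K ↥(X ⊓ H) + 1 = Module.finrank K X := by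
  have h1 := Submodule.finrank_sup_add_finrank_inf_eq X H
  have h2 : X ⊔ H = ⊤ := hH.2 _ (lt_of_le_of_ne le_sup_right fun h => hX (h ▸ le_sup_left))
  have h3 : Module.finrank K (V ⧸ H) = 1 := by
    have := isSimpleModule_iff_isCoatom.2 hH
    exact (isSimpleModule_iff_finrank_eq_one).1 this
  have h4 := H.finrank_quotient_add_finrank
  rw [h2, finrank_top] at h1
  omega

/-- A subspace of dimension at least two is the sum of its intersections with hyperplanes that
have no nonzero common vector in it. -/
theorem le_iSup_inf_coatom [FiniteDimensional K V] {ι : Type*} {X : Submodule K V}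
    {B : Finset ι} {f : ι → Submodule K V}
    (hB : ∀ H ∈ B, IsCoatom (f H)) (hX : X ⊓ B.inf f = ⊥) (h2 : 2 ≤ Module.finrank K X) :
    X ≤ ⨆ H ∈ B, X ⊓ f H := by
  have key : ∀ Y : Submodule K V, Y ≤ X → Y ≠ ⊥ → ∃ H ∈ B, ¬ Y ≤ f H := by
    intro Y hYX hY
    by_contra! h
    exact hY (eq_bot_iff.2 (hX ▸ le_inf hYX (Finset.le_inf h)))
  by_cases hc : ∃ H ∈ B, X ≤ f H
  · obtain ⟨H, hH, hXH⟩ := hc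
    exact le_iSup₂_of_le H hH (le_inf le_rfl hXH)
  push Not at hc
  obtain ⟨H, hH, -⟩ := key X le_rfl (by rintro rfl; simp at h2)
  have e1 := finrank_inf_coatom (hB H hH) (hc H hH)
  -- As `dim X ≥ 2`, the first section is nonzero, so some `f H'` does not contain it. The two
  -- sections are then distinct of codimension one, hence span `X`.
  obtain ⟨H', hH', h'⟩ := key (X ⊓ f H) inf_le_left (by intro h; rw [h, finrank_bot] at e1; omega)
  have e2 := finrank_inf_coatom (hB H' hH') (hc H' hH')
  have hlt : X ⊓ f H < (X ⊓ f H) ⊔ (X ⊓ f H') := by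
    refine lt_of_le_of_ne le_sup_left fun h => h' ?_
    have hle : X ⊓ f H' ≤ X ⊓ f H := h ▸ le_sup_right
    rw [← Submodule.eq_of_le_of_finrank_eq hle (by omega)]
    exact inf_le_right
  have e3 := Submodule.finrank_lt_finrank_of_lt hlt
  have hle : (X ⊓ f H) ⊔ (X ⊓ f H') ≤ X := sup_le inf_le_left inf_le_left
  have : (X ⊓ f H) ⊔ (X ⊓ f H') = X := by
    apply Submodule.eq_of_le_of_finrank_le hle
    omega
  calc X = (X ⊓ f H) ⊔ (X ⊓ f H') := this.symm
    _ ≤ _ := sup_le (le_iSup₂_of_le H hH le_rfl) (le_iSup₂_of_le H' hH' le_rfl)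

/-- If `v ∈ X` lies in all members of `B`, but not in the hyperplane `H`, then intersecting
with `H` distributes over the sum of the `X ⊓ f H'` with `H' ∈ B`. -/
theorem inf_iSup_le_of_not_le {ι : Type*} {X H : Submodule K V} {B : Finset ι} {f : ι → Submodule K V}
    (hH : IsCoatom H) (hX : ¬ X ⊓ B.inf f ≤ H) :
    H ⊓ ⨆ H' ∈ B, X ⊓ f H' ≤ ⨆ H' ∈ B, X ⊓ H ⊓ f H' := by
  obtain ⟨v, hv, hvH⟩ := SetLike.not_le_iff_exists.1 hX
  have hvX : K ∙ v ≤ X ⊓ B.inf f := (Submodule.span_singleton_le_iff_mem _ _).2 hv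
  have htop : H ⊔ K ∙ v = ⊤ := hH.2 _ (lt_of_le_of_ne le_sup_left fun h => hvH
    (h ▸ (le_sup_right : K ∙ v ≤ H ⊔ K ∙ v) (Submodule.mem_span_singleton_self v)))
  have hbot : (K ∙ v) ⊓ H = ⊥ := by
    rw [← disjoint_iff, disjoint_comm]
    exact Submodule.disjoint_span_singleton_of_notMem hvH
  -- Every `X ⊓ f H'` contains `v`; as `V = H ⊕ K ∙ v`, the modular law splits off the line `K ∙ v`.
  have h1 : ⨆ H' ∈ B, X ⊓ f H' ≤ (⨆ H' ∈ B, X ⊓ H ⊓ f H') ⊔ K ∙ v := by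
    refine iSup₂_le fun H' hH' => ?_
    have h3 : K ∙ v ≤ X ⊓ f H' :=
      hvX.trans (inf_le_inf_left _ (Finset.inf_le (f := f) hH'))
    calc X ⊓ f H' = ((K ∙ v) ⊔ H) ⊓ (X ⊓ f H') := by rw [sup_comm, htop, top_inf_eq]
      _ = (K ∙ v) ⊔ H ⊓ (X ⊓ f H') := sup_inf_assoc_of_le _ h3
      _ ≤ _ := by
        rw [sup_comm]
        refine sup_le_sup_right (le_iSup₂_of_le H' hH' ?_) _
        rw [inf_left_comm, inf_assoc]
  have h4 : (⨆ H' ∈ B, X ⊓ H ⊓ f H') ≤ H :=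
    iSup₂_le fun H' _ => inf_le_left.trans inf_le_right
  calc _ ≤ ((⨆ H' ∈ B, X ⊓ H ⊓ f H') ⊔ K ∙ v) ⊓ H := by
        rw [inf_comm]; exact inf_le_inf_right _ h1
    _ = _ := by rw [sup_inf_assoc_of_le _ h4, hbot, sup_bot_eq]

end Lattice

/-! ### Meets and hyperplanes in the intersection poset. -/

section Poset

variable {K : Type u} [Field K] {V : Type v} [AddCommGroup V] [Module K V]
  {A : Finset (Submodule K V)}

theorem mem_intersectionPoset {X : Submodule K V} :
    X ∈ intersectionPoset A ↔ ∃ S ⊆ A, S.inf id = X := by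
  simp [intersectionPoset]

theorem inf_mem_intersectionPoset {X Y : Submodule K V} (hX : X ∈ intersectionPoset A)
    (hY : Y ∈ intersectionPoset A) : X ⊓ Y ∈ intersectionPoset A := by
  classical
  obtain ⟨S, hS, rfl⟩ := mem_intersectionPoset.1 hX
  obtain ⟨T, hT, rfl⟩ := mem_intersectionPoset.1 hY
  exact mem_intersectionPoset.2 ⟨S ∪ T, Finset.union_subset hS hT, Finset.inf_union⟩

theorem mem_intersectionPoset_of_mem {H : Submodule K V} (hH : H ∈ A) :
    H ∈ intersectionPoset A :=
  mem_intersectionPoset.2 ⟨{H}, by simpa using hH, by simp⟩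

/-- The intersection of two elements of the intersection poset. -/
def meet (X Y : intersectionPoset A) : intersectionPoset A :=
  ⟨X.1 ⊓ Y.1, inf_mem_intersectionPoset X.2 Y.2⟩

theorem le_meet_iff {X Y Z : intersectionPoset A} : Z ≤ meet X Y ↔ Z ≤ X ∧ Z ≤ Y :=
  le_inf_iff (c := Z.1)

theorem meet_le_left {X Y : intersectionPoset A} : meet X Y ≤ X := (le_meet_iff.1 le_rfl).1

theorem meet_le_right {X Y : intersectionPoset A} : meet X Y ≤ Y := (le_meet_iff.1 le_rfl).2

theorem meet_right_comm (X Y Z : intersectionPoset A) :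
    meet (meet X Y) Z = meet (meet X Z) Y :=
  Subtype.ext (inf_right_comm _ _ _)

theorem meet_meet_meet (X Y Z : intersectionPoset A) :
    meet (meet X Y) (meet X Z) = meet (meet X Y) Z :=
  Subtype.ext (by simp only [meet]; rw [← inf_assoc, inf_right_comm X.1 Y.1 X.1, inf_idem])

/-- An element of the intersection poset is below `X` exactly if it lies in every hyperplane
that contains `X`. -/
theorem le_of_forall_hyperplane {X Y : intersectionPoset A}
    (h : ∀ H ∈ A, Y.1 ≤ H → X.1 ≤ H) : X ≤ Y := by
  obtain ⟨S, hS, hSY⟩ := mem_intersectionPoset.1 Y.2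
  change X.1 ≤ Y.1
  rw [← hSY]
  exact Finset.le_inf fun H hH => h H (hS hH) (hSY ▸ Finset.inf_le hH)

theorem eq_of_le_of_finrank_le [FiniteDimensional K V] {X Y : intersectionPoset A} (h : X ≤ Y)
    (hd : Module.finrank K Y.1 ≤ Module.finrank K X.1) : X = Y :=
  Subtype.ext (Submodule.eq_of_le_of_finrank_le h hd)

theorem finrank_mono [FiniteDimensional K V] {X Y : intersectionPoset A} (h : X ≤ Y) :
    Module.finrank K X.1 ≤ Module.finrank K Y.1 :=
  Submodule.finrank_mono h

end Poset

end HyperplaneResolution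

namespace HyperplaneResolution

/-! ### Construction of the linear sequence. -/

section Construction

variable {K : Type u} [Field K] {V : Type v} [AddCommGroup V] [Module K V]
  {A : Finset (Submodule K V)}

/-- The sequence is linear: `F i` is the direct sum of the `F i ^ X` with `dim X = i + 1`, the
subspace `F i ^ Y` is the sum of those with `X ≤ Y`, and `φ i` identifies each of them with the
syzygy space `X ^ i`. -/
structure ArrangementSequence.IsLinear (R : ArrangementSequence A) : Prop where
  indep : ∀ i, iSupIndep
    fun X : {X : intersectionPoset A // Module.finrank K X.1 = i + 1} => R.fil i X.1
  iSup_eq_top : ∀ i,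
    ⨆ X : {X : intersectionPoset A // Module.finrank K X.1 = i + 1}, R.fil i X.1 = ⊤
  fil_eq : ∀ i Y, R.fil i Y =
    ⨆ X ∈ {X : {X : intersectionPoset A // Module.finrank K X.1 = i + 1} | X.1 ≤ Y}, R.fil i X.1
  bijOn : ∀ i X, Module.finrank K X.1 = i + 1 →
    Set.BijOn (R.φ i) (R.fil i X : Set (R.F i)) (R.syz i X : Set (augTerm V R.F i))

section Cover

variable (A) (i : ℕ) {M : ModuleCat.{v} K} (s : intersectionPoset A → Submodule K M)

/-- The direct sum of the `s X` with `dim X = i + 1`. -/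
def cover : ModuleCat.{v} K :=
  ModuleCat.of K (∀ X : {X : intersectionPoset A // Module.finrank K X.1 = i + 1}, s X.1)

open scoped Classical in
/-- The sum of the summands of `cover A i s` that belong to some `X ≤ Y`. -/
noncomputable def coverFil (Y : intersectionPoset A) : Submodule K (cover A i s) :=
  ⨆ X ∈ {X : {X : intersectionPoset A // Module.finrank K X.1 = i + 1} | X.1 ≤ Y},
    LinearMap.range (LinearMap.single K
      (fun X : {X : intersectionPoset A // Module.finrank K X.1 = i + 1} => s X.1) X)

open scoped Classical in
/-- The sum of the inclusions `s X → M`. -/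
noncomputable def coverMap : cover A i s →ₗ[K] M :=
  LinearMap.lsum K (fun X : {X : intersectionPoset A // Module.finrank K X.1 = i + 1} => s X.1) K
    fun X => (s X.1).subtype

variable [FiniteDimensional K V]

open scoped Classical in
theorem coverFil_of_finrank_eq
    (X : {X : intersectionPoset A // Module.finrank K X.1 = i + 1}) :
    coverFil A i s X.1 = LinearMap.range (LinearMap.single K
      (fun X : {X : intersectionPoset A // Module.finrank K X.1 = i + 1} => s X.1) X) := by
  refine le_antisymm (iSup₂_le fun Z hZ => ?_) (le_iSup₂_of_le X (le_refl X.1) le_rfl)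
  have : Z = X := Subtype.ext (eq_of_le_of_finrank_le hZ (by rw [Z.2, X.2]))
  rw [this]
  exact le_rfl

theorem coverFil_indep : iSupIndep
    fun X : {X : intersectionPoset A // Module.finrank K X.1 = i + 1} => coverFil A i s X.1 := by
  classical
  simp only [coverFil_of_finrank_eq]
  intro X
  have h := LinearMap.disjoint_single_single K
    (fun X : {X : intersectionPoset A // Module.finrank K X.1 = i + 1} => s X.1) {X} {X}ᶜ
    disjoint_compl_right
  rw [iSup_singleton] at h
  exact h

theorem coverFil_iSup_eq_top :
    ⨆ X : {X : intersectionPoset A // Module.finrank K X.1 = i + 1}, coverFil A i s X.1 = ⊤ := by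
  classical
  simp only [coverFil_of_finrank_eq]
  exact LinearMap.iSup_range_single K _

theorem coverFil_eq (Y : intersectionPoset A) : coverFil A i s Y =
    ⨆ X ∈ {X : {X : intersectionPoset A // Module.finrank K X.1 = i + 1} | X.1 ≤ Y},
      coverFil A i s X.1 := by
  simp only [coverFil_of_finrank_eq]
  rfl

/-- On the single summand indexed by `X`, the map is the inclusion of `s X`. -/
theorem coverMap_bijOn (X : intersectionPoset A) (hX : Module.finrank K X.1 = i + 1) :
    Set.BijOn (coverMap A i s) (coverFil A i s X : Set (cover A i s)) (s X : Set M) := by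
  classical
  have key : ∀ v : s X, coverMap A i s (LinearMap.single K
      (fun X : {X : intersectionPoset A // Module.finrank K X.1 = i + 1} => s X.1) ⟨X, hX⟩ v)
      = v.1 := fun v => LinearMap.lsum_piSingle _ _ _ _ _ _
  rw [coverFil_of_finrank_eq A i s ⟨X, hX⟩]
  refine ⟨?_, ?_, ?_⟩
  · rintro _ ⟨v, rfl⟩
    rw [key]
    exact v.2
  · rintro _ ⟨v, rfl⟩ _ ⟨w, rfl⟩ h
    rw [key, key] at h
    rw [Subtype.ext h]
  · intro v hv
    exact ⟨_, ⟨⟨v, hv⟩, rfl⟩, key _⟩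

end Cover

variable (A) in
/-- The spaces `V, F 0, F 1, …` of the linear resolution, with their syzygy spaces. -/
noncomputable def stage : ℕ → Σ M : ModuleCat.{v} K, intersectionPoset A → Submodule K M
  | 0 => ⟨ModuleCat.of K V, fun X => X.1⟩
  | i + 1 => ⟨cover A i (stage i).2, fun X =>
      coverFil A i (stage i).2 X ⊓ LinearMap.ker (coverMap A i (stage i).2)⟩

variable (A) in
/-- The linear resolution of the arrangement. -/
noncomputable def linearSequence : ArrangementSequence A where
  F i := cover A i (stage A i).2
  fil i := coverFil A i (stage A i).2
  φ
    | 0 => coverMap A 0 (stage A 0).2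
    | i + 1 => coverMap A (i + 1) (stage A (i + 1)).2

theorem linearSequence_isLinear [FiniteDimensional K V] : (linearSequence A).IsLinear where
  indep i := coverFil_indep A i (stage A i).2
  iSup_eq_top i := coverFil_iSup_eq_top A i (stage A i).2
  fil_eq i := coverFil_eq A i (stage A i).2
  bijOn
    -- `syz (i + 1)` involves `φ i`, itself defined by cases, so it unfolds to `stage` only after a
    -- second case split.
    | 0, X, hX => coverMap_bijOn A 0 (stage A 0).2 X hX
    | 1, X, hX => coverMap_bijOn A 1 (stage A 1).2 X hX
    | i + 2, X, hX => coverMap_bijOn A (i + 2) (stage A (i + 2)).2 X hX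

end Construction

end HyperplaneResolution

namespace HyperplaneResolution

/-! ### The distributive law for syzygy spaces. -/

namespace ArrangementSequence

variable {K : Type u} [Field K] {V : Type v} [AddCommGroup V] [Module K V]
  {A : Finset (Submodule K V)} {R : ArrangementSequence A}

/-- The coordinate subspaces `F (i - 1) ^ X` containing the syzygy spaces `X ^ i`, with
`X` itself in degree zero. -/
def filAug (R : ArrangementSequence A) :
    ∀ i, intersectionPoset A → Submodule K (augTerm V R.F i)
  | 0, X => R.syz 0 X
  | i + 1, X => R.fil i X

theorem syz_le_filAug : ∀ (i : ℕ) (X : intersectionPoset A), R.syz i X ≤ R.filAug i X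
  | 0, _ => le_rfl
  | _ + 1, _ => inf_le_left

theorem mem_syz_succ {i : ℕ} {X : intersectionPoset A} {x : R.F i} :
    x ∈ (R.syz (i + 1) X : Submodule K (R.F i)) ↔ x ∈ R.fil i X ∧ R.φ i x = 0 :=
  Iff.rfl

/-- No member of `B` contains the intersection of `X` with the other members. -/
def Irredundant (X : intersectionPoset A) (B : Finset (intersectionPoset A)) : Prop :=
  ∀ H ∈ B, ∀ C ⊆ B, H ∉ C → ¬ X.1 ⊓ C.inf Subtype.val ≤ H.1

theorem Irredundant.mono {X : intersectionPoset A} {B C : Finset (intersectionPoset A)}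
    (h : Irredundant X B) (hC : C ⊆ B) : Irredundant X C :=
  fun H hH D hD hHD => h H (hC hH) D (hD.trans hC) hHD

/-- A family `D` violating irredundancy on `meet X H` gives the violating family `insert H D` on
`X`. -/
theorem Irredundant.meet {X H : intersectionPoset A} {B C : Finset (intersectionPoset A)}
    (h : Irredundant X B) (hH : H ∈ B) (hC : C ⊆ B) (hHC : H ∉ C) :
    Irredundant (meet X H) C := by
  classical
  intro H' hH' D hD hHD hle
  have hne : H' ≠ H := fun e => hHC (e ▸ hH')
  refine h H' (hC hH') (insert H D) ?_ (by simp [hne, hHD]) (le_trans ?_ hle)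
  · exact Finset.insert_subset hH (hD.trans hC)
  · rw [Finset.inf_insert, ← inf_assoc]
    exact le_rfl

namespace IsLinear

variable (hR : R.IsLinear)
include hR

theorem fil_mono (i : ℕ) {X Y : intersectionPoset A} (h : X ≤ Y) : R.fil i X ≤ R.fil i Y := by
  rw [hR.fil_eq i X, hR.fil_eq i Y]
  exact biSup_mono fun Z hZ => le_trans hZ h

theorem fil_meet (i : ℕ) (X Y : intersectionPoset A) :
    R.fil i (meet X Y) = R.fil i X ⊓ R.fil i Y := by
  refine le_antisymm (le_inf (hR.fil_mono i meet_le_left) (hR.fil_mono i meet_le_right)) ?_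
  rw [hR.fil_eq i X, hR.fil_eq i Y, biSup_inf_biSup_of_iSupIndep (hR.indep i)]
  exact iSup₂_le fun Z hZ => hR.fil_mono i (le_meet_iff.2 hZ)

/-- The subspaces `F i ^ X` satisfy the distributive law. -/
theorem fil_inf_iSup_le {ι : Type*} (i : ℕ) (X : intersectionPoset A) (B : Finset ι)
    (f : ι → intersectionPoset A) :
    R.fil i X ⊓ ⨆ H ∈ B, R.fil i (f H) ≤ ⨆ H ∈ B, R.fil i (meet X (f H)) := by
  have h : ⨆ H ∈ B, R.fil i (f H) ≤
      ⨆ Z ∈ {Z : {Z : intersectionPoset A // Module.finrank K Z.1 = i + 1} |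
        ∃ H ∈ B, Z.1 ≤ f H}, R.fil i Z.1 := by
    refine iSup₂_le fun H hH => ?_
    rw [hR.fil_eq i (f H)]
    exact biSup_mono fun Z hZ => ⟨H, hH, hZ⟩
  refine (inf_le_inf_left _ h).trans ?_
  rw [hR.fil_eq i X, biSup_inf_biSup_of_iSupIndep (hR.indep i)]
  refine iSup₂_le fun Z hZ => ?_
  obtain ⟨hZX, H, hH, hZH⟩ := hZ
  exact le_iSup₂_of_le H hH (hR.fil_mono i (le_meet_iff.2 ⟨hZX, hZH⟩))

theorem syz_mono : ∀ (i : ℕ) {X Y : intersectionPoset A}, X ≤ Y → R.syz i X ≤ R.syz i Y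
  | 0, _, _, h => h
  | i + 1, _, _, h => inf_le_inf_right (LinearMap.ker (R.φ i)) (hR.fil_mono i h)

/-- The easy half of exactness: a summand `F i ^ Z` with `Z ≤ X` maps to `Z^i`, which lies in `X^i`.
-/
theorem map_fil_le (i : ℕ) (X : intersectionPoset A) :
    (R.fil i X).map (R.φ i) ≤ R.syz i X := by
  rw [hR.fil_eq i X]
  simp only [Submodule.map_iSup]
  refine iSup₂_le fun Z hZ => le_trans ?_ (hR.syz_mono i hZ)
  exact Submodule.map_le_iff_le_comap.2 (hR.bijOn i Z.1 Z.2).mapsTo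

variable [FiniteDimensional K V]

theorem fil_eq_bot (i : ℕ) (X : intersectionPoset A) (h : Module.finrank K X.1 ≤ i) :
    R.fil i X = ⊥ := by
  rw [hR.fil_eq i X, eq_bot_iff]
  refine iSup₂_le fun Z hZ => ?_
  have := finrank_mono hZ
  have := Z.2
  omega

/-- For `k = i + 1`, either `dim X ≤ i` and `F i ^ X` has no summands, or `dim X = i + 1` and `φ i`
is injective on it. -/
theorem syz_eq_bot (k : ℕ) (X : intersectionPoset A) (h : Module.finrank K X.1 ≤ k) :
    R.syz k X = ⊥ := by
  cases k with
  | zero => exact (Submodule.finrank_eq_zero (S := X.1)).1 (Nat.le_zero.1 h)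
  | succ i =>
    rw [eq_bot_iff]
    intro x hx
    change R.F i at x
    obtain ⟨hx1, hx2⟩ := mem_syz_succ.1 hx
    rcases h.lt_or_eq with h | h
    · rw [hR.fil_eq_bot i X (by omega)] at hx1
      exact hx1
    · exact (hR.bijOn i X h).injOn hx1 (R.fil i X).zero_mem (hx2.trans (map_zero (R.φ i)).symm)

/-- The distributive law for syzygy spaces which drives the induction. -/
theorem syz_inf_iSup_syz_le (i : ℕ)
    (ih : ∀ (X : intersectionPoset A) (B : Finset (intersectionPoset A)),
      (∀ H ∈ B, IsCoatom H.1) →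
      (Irredundant X B ∨ X.1 ⊓ B.inf Subtype.val = ⊥ ∧ i + 2 ≤ Module.finrank K X.1) →
      R.syz i X ⊓ ⨆ H ∈ B, R.filAug i (meet X H) ≤ ⨆ H ∈ B, R.syz i (meet X H))
    (X H : intersectionPoset A) (B : Finset (intersectionPoset A)) (hH : IsCoatom H.1)
    (hB : ∀ H ∈ B, IsCoatom H.1)
    (h : (¬ X.1 ⊓ B.inf Subtype.val ≤ H.1) ∧ Irredundant (meet X H) B ∨
      (meet X H).1 ⊓ B.inf Subtype.val = ⊥ ∧ i + 2 ≤ Module.finrank K (meet X H).1) :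
    R.syz i (meet X H) ⊓ ⨆ H' ∈ B, R.syz i (meet X H') ≤
      ⨆ H' ∈ B, R.syz i (meet (meet X H) H') := by
  cases i with
  | zero =>
    -- Degree zero concerns subspaces of `V`: either a vector outside `H` common to `X` and all of
    -- `B` gives distributivity, or the sections already span `X ⊓ H`.
    rcases h with ⟨h, -⟩ | ⟨h, h2⟩
    · exact (inf_le_inf_right _ (inf_le_right : X.1 ⊓ H.1 ≤ H.1)).trans
        (inf_iSup_le_of_not_le hH h)
    · exact (inf_le_left : _ ≤ (meet X H).1).trans (le_iSup_inf_coatom hB h h2)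
  | succ j =>
    -- By the law for `meet X H`, only support on the triple intersections is needed; distributivity
    -- in `F j` provides it.
    refine le_trans ?_ (ih (meet X H) B hB (h.imp_left And.right))
    refine le_inf inf_le_left ((inf_le_inf (syz_le_filAug _ _) (iSup₂_mono fun H' _ =>
      syz_le_filAug _ _)).trans ?_)
    refine (hR.fil_inf_iSup_le j (meet X H) B fun H' => meet X H').trans ?_
    exact iSup₂_mono fun H' _ => le_of_eq (by rw [meet_meet_meet]; rfl)

/-- An inductive step: syzygies supported on the hyperplanes in `B` are sums of syzygies of the
hyperplanes. -/
theorem syz_succ_inf_iSup_le (i : ℕ)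
    (hsurj : ∀ X, R.syz i X ≤ (R.fil i X).map (R.φ i))
    (ih : ∀ (X : intersectionPoset A) (B : Finset (intersectionPoset A)),
      (∀ H ∈ B, IsCoatom H.1) →
      (Irredundant X B ∨ X.1 ⊓ B.inf Subtype.val = ⊥ ∧ i + 2 ≤ Module.finrank K X.1) →
      R.syz i X ⊓ ⨆ H ∈ B, R.filAug i (meet X H) ≤ ⨆ H ∈ B, R.syz i (meet X H))
    (X : intersectionPoset A) (B : Finset (intersectionPoset A))
    (hB : ∀ H ∈ B, IsCoatom H.1)
    (h : Irredundant X B ∨ X.1 ⊓ B.inf Subtype.val = ⊥ ∧ i + 3 ≤ Module.finrank K X.1) :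
    R.syz (i + 1) X ⊓ ⨆ H ∈ B, R.filAug (i + 1) (meet X H) ≤
      ⨆ H ∈ B, R.syz (i + 1) (meet X H) := by
  classical
  induction B using Finset.strongInduction with
  | H B ihB =>
  rcases B.eq_empty_or_nonempty with rfl | ⟨H₀, hH₀⟩
  · simp
  -- a hyperplane whose removal preserves the hypotheses
  obtain ⟨H, C, hHC, rfl, h1, h2⟩ : ∃ H C, ∃ _ : H ∉ C, insert H C = B ∧
      (Irredundant X C ∨ X.1 ⊓ C.inf Subtype.val = ⊥ ∧ i + 3 ≤ Module.finrank K X.1) ∧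
      ((¬ X.1 ⊓ C.inf Subtype.val ≤ H.1) ∧ Irredundant (meet X H) C ∨
        (meet X H).1 ⊓ C.inf Subtype.val = ⊥ ∧ i + 2 ≤ Module.finrank K (meet X H).1) := by
    -- In the irredundant case any member can be removed. Otherwise a member containing the
    -- intersection of `X` with the rest is removed, which keeps the total intersection zero.
    by_cases hirr : Irredundant X B
    · refine ⟨H₀, B.erase H₀, Finset.notMem_erase _ _, Finset.insert_erase hH₀,
        Or.inl (hirr.mono (Finset.erase_subset _ _)), Or.inl ⟨?_, ?_⟩⟩
      · exact hirr H₀ hH₀ _ (Finset.erase_subset _ _) (Finset.notMem_erase _ _)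
      · exact hirr.meet hH₀ (Finset.erase_subset _ _) (Finset.notMem_erase _ _)
    · obtain ⟨hbot, hd⟩ := h.resolve_left hirr
      unfold Irredundant at hirr
      push Not at hirr
      obtain ⟨H, hH, D, hD, hHD, hle⟩ := hirr
      have hle' : X.1 ⊓ (B.erase H).inf Subtype.val ≤ H.1 :=
        (inf_le_inf_left _ (Finset.inf_mono (Finset.subset_erase.2 ⟨hD, hHD⟩))).trans hle
      have hbot' : X.1 ⊓ (B.erase H).inf Subtype.val = ⊥ := by
        rw [← Finset.insert_erase hH, Finset.inf_insert, inf_left_comm] at hbot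
        rwa [inf_eq_right.2 hle'] at hbot
      refine ⟨H, B.erase H, Finset.notMem_erase _ _, Finset.insert_erase hH,
        Or.inr ⟨hbot', hd⟩, Or.inr ⟨?_, ?_⟩⟩
      · exact eq_bot_iff.2 (hbot' ▸ inf_le_inf_right _ inf_le_left)
      -- Cutting with `H` costs at most one dimension, so `i + 3` for `X` leaves the `i + 2` needed
      -- one degree lower.
      · by_cases hXH : X.1 ≤ H.1
        · rw [show (meet X H).1 = X.1 from inf_eq_left.2 hXH]
          omega
        · have := finrank_inf_coatom (hB H hH) hXH
          change i + 2 ≤ Module.finrank K ↥(X.1 ⊓ H.1)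
          omega
  rw [Finset.iSup_insert, Finset.iSup_insert]
  intro x hx
  obtain ⟨hx, hxB⟩ := hx
  obtain ⟨hxX, hx0⟩ := mem_syz_succ.1 hx
  obtain ⟨a, ha, c, hc, rfl⟩ := Submodule.mem_sup.1 hxB
  change R.F i at a c
  have hac : R.φ i a + R.φ i c = 0 := by rw [← map_add]; exact hx0
  have hmap : ∀ Y : intersectionPoset A, (⨆ H' ∈ C, R.fil i (meet Y H')).map (R.φ i) ≤
      ⨆ H' ∈ C, R.syz i (meet Y H') := by
    intro Y
    simp only [Submodule.map_iSup]
    exact iSup₂_mono fun H' _ => hR.map_fil_le i _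
  -- `φ a = -φ c` is a syzygy of `meet X H` and also a sum of syzygies from `C`, so it comes from
  -- the triple intersections.
  have hφa : R.φ i a ∈ ⨆ H' ∈ C, R.syz i (meet (meet X H) H') := by
    refine hR.syz_inf_iSup_syz_le i ih X H C (hB H (Finset.mem_insert_self _ _))
      (fun H' hH' => hB H' (Finset.mem_insert_of_mem hH')) h2 ⟨?_, ?_⟩
    · exact hR.map_fil_le i _ (Submodule.mem_map_of_mem ha)
    · rw [eq_neg_of_add_eq_zero_left hac]
      exact neg_mem (hmap X (Submodule.mem_map_of_mem hc))
  have hφa' : R.φ i a ∈ (⨆ H' ∈ C, R.fil i (meet (meet X H) H')).map (R.φ i) := by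
    simp only [Submodule.map_iSup]
    exact (iSup₂_mono fun H' _ => hsurj _ :
      ⨆ H' ∈ C, R.syz i (meet (meet X H) H') ≤ _) hφa
  obtain ⟨y, hy, hya⟩ := hφa'
  have hyH : y ∈ R.fil i (meet X H) :=
    (iSup₂_le fun H' _ => hR.fil_mono i meet_le_left :
      ⨆ H' ∈ C, R.fil i (meet (meet X H) H') ≤ _) hy
  have hyC : y ∈ ⨆ H' ∈ C, R.fil i (meet X H') :=
    (iSup₂_mono fun H' _ => hR.fil_mono i (by rw [meet_right_comm]; exact meet_le_left) :
      ⨆ H' ∈ C, R.fil i (meet (meet X H) H') ≤ _) hy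
  have hcX : c ∈ R.fil i X :=
    (iSup₂_le fun H' _ => hR.fil_mono i meet_le_left :
      ⨆ H' ∈ C, R.fil i (meet X H') ≤ _) hc
  have hyX : y ∈ R.fil i X := hR.fil_mono i meet_le_left hyH
  -- The lift `y` of `φ a` lies in both parts; moving it across turns both into syzygies, and `c +
  -- y` is supported on the smaller set `C`.
  refine Submodule.mem_sup.2 ⟨a - y, ?_, c + y, ?_, ?_⟩
  · exact mem_syz_succ.2 ⟨sub_mem ha hyH, by rw [map_sub, hya, sub_self]⟩
  · refine ihB C (Finset.ssubset_insert hHC)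
      (fun H' hH' => hB H' (Finset.mem_insert_of_mem hH')) h1 ⟨?_, ?_⟩
    · exact mem_syz_succ.2 ⟨add_mem hcX hyX, by rw [map_add, hya, add_comm]; exact hac⟩
    · exact add_mem hc hyC
  · exact sub_add_add_cancel a c y

end IsLinear
end ArrangementSequence
end HyperplaneResolution

namespace HyperplaneResolution

/-! ### Exactness, coordinate structure and minimality. -/

namespace ArrangementSequence

variable {K : Type u} [Field K] {V : Type v} [AddCommGroup V] [Module K V]
  {A : Finset (Submodule K V)} {R : ArrangementSequence A}

namespace IsLinear

variable (hR : R.IsLinear)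
include hR

/-- Each vector of an adapted basis of `F i` lies in some `F i ^ X` with `dim X = i + 1`. -/
theorem exists_mem_fil {i n : ℕ} {b : Module.Basis (Fin n) K (R.F i)}
    (hb : IsAdaptedBasis (R.fil i) b) (j : Fin n) :
    ∃ X : intersectionPoset A, Module.finrank K X.1 = i + 1 ∧ b j ∈ R.fil i X := by
  choose S hS using hb
  by_contra! h
  -- Otherwise each summand, and hence `F i`, is spanned by basis vectors other than `b j`.
  have hle : ⊤ ≤ Submodule.span K (b '' {j}ᶜ) := by
    rw [← hR.iSup_eq_top i]
    refine iSup_le fun X => ?_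
    rw [hS X.1]
    refine Submodule.span_mono (Set.image_mono fun l hl hlj => h X.1 X.2 ?_)
    rw [hS X.1]
    exact Submodule.subset_span ⟨l, hl, by rw [hlj]⟩
  exact b.linearIndependent.notMem_span_image (s := {j}ᶜ) (x := j) (by simp)
    (hle Submodule.mem_top)

variable [FiniteDimensional K V]

/-- In positive degree, a summand of `F j ^ X` belongs to some `Z` with `dim Z = j + 1 < dim X`, so
a hyperplane of `A` contains `Z` but not `X`. -/
theorem filAug_le_iSup (hA : IsHyperplaneArrangement A) (i : ℕ) (X : intersectionPoset A)
    (B : Finset (intersectionPoset A)) (hB : ∀ H : intersectionPoset A, H ∈ B ↔ H.1 ∈ A ∧ ¬ X ≤ H)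
    (hbot : X.1 ⊓ B.inf Subtype.val = ⊥) (hX : i + 2 ≤ Module.finrank K X.1) :
    R.filAug i X ≤ ⨆ H ∈ B, R.filAug i (meet X H) := by
  cases i with
  | zero =>
    change X.1 ≤ ⨆ H ∈ B, X.1 ⊓ H.1
    exact le_iSup_inf_coatom (fun H hH => hA _ ((hB H).1 hH).1) hbot hX
  | succ j =>
    change R.fil j X ≤ ⨆ H ∈ B, R.fil j (meet X H)
    rw [hR.fil_eq j X]
    refine iSup₂_le fun Z hZ => ?_
    obtain ⟨H, hHA, hZH, hXH⟩ : ∃ H ∈ A, Z.1.1 ≤ H ∧ ¬ X.1 ≤ H := by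
      by_contra! h
      have := finrank_mono (le_of_forall_hyperplane h)
      have := Z.2
      omega
    refine le_iSup₂_of_le ⟨H, mem_intersectionPoset_of_mem hHA⟩ ((hB _).2 ⟨hHA, hXH⟩) ?_
    exact hR.fil_mono j (le_meet_iff.2 ⟨hZ, hZH⟩)

/-- Surjectivity of `F i ^ X → X ^ i`, given that syzygies supported on hyperplanes are sums of
syzygies of the hyperplanes. -/
theorem syz_le_map_fil_of (hA : IsHyperplaneArrangement A) (hess : IsEssential A) (i : ℕ)
    (ih : ∀ (X : intersectionPoset A) (B : Finset (intersectionPoset A)),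
      (∀ H ∈ B, IsCoatom H.1) →
      (Irredundant X B ∨ X.1 ⊓ B.inf Subtype.val = ⊥ ∧ i + 2 ≤ Module.finrank K X.1) →
      R.syz i X ⊓ ⨆ H ∈ B, R.filAug i (meet X H) ≤ ⨆ H ∈ B, R.syz i (meet X H))
    (X : intersectionPoset A) : R.syz i X ≤ (R.fil i X).map (R.φ i) := by
  classical
  induction h : Module.finrank K X.1 using Nat.strong_induction_on generalizing X with
  | _ n hn =>
  subst h
  rcases lt_trichotomy (Module.finrank K X.1) (i + 1) with h | h | h
  · rw [hR.syz_eq_bot i X (by omega)]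
    exact bot_le
  · exact (hR.bijOn i X h).surjOn
  let B : Finset (intersectionPoset A) := {H | H.1 ∈ A ∧ ¬ X ≤ H}
  have hB : ∀ H : intersectionPoset A, H ∈ B ↔ H.1 ∈ A ∧ ¬ X ≤ H := by simp [B]
  have hbot : X.1 ⊓ B.inf Subtype.val = ⊥ := by
    rw [eq_bot_iff, ← (hess : A.inf id = ⊥)]
    refine Finset.le_inf fun H hH => ?_
    by_cases hXH : X.1 ≤ H
    · exact inf_le_left.trans hXH
    · exact inf_le_right.trans
        (Finset.inf_le (f := Subtype.val) ((hB ⟨H, mem_intersectionPoset_of_mem hH⟩).2 ⟨hH, hXH⟩))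
  have hsyz := ih X B (fun H hH => hA _ ((hB H).1 hH).1) (Or.inr ⟨hbot, h⟩)
  -- The support condition is vacuous here, so `X^i` is a sum of syzygy spaces of proper sections,
  -- to which induction on dimension applies.
  rw [inf_eq_left.2 ((syz_le_filAug i X).trans (hR.filAug_le_iSup hA i X B hB hbot h))] at hsyz
  refine hsyz.trans (iSup₂_le fun H hH => ?_)
  have hlt := finrank_inf_coatom (hA _ ((hB H).1 hH).1) ((hB H).1 hH).2
  exact (hn _ (by change Module.finrank K ↥(X.1 ⊓ H.1) < _; omega) (meet X H) rfl).trans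
    (Submodule.map_mono (hR.fil_mono i meet_le_left))

/-- A syzygy of `X` supported on the hyperplanes in `B` is a sum of syzygies of their
intersections with `X`. -/
theorem syz_inf_iSup_le (hA : IsHyperplaneArrangement A) (hess : IsEssential A) (i : ℕ) :
    ∀ (X : intersectionPoset A) (B : Finset (intersectionPoset A)),
      (∀ H ∈ B, IsCoatom H.1) →
      (Irredundant X B ∨ X.1 ⊓ B.inf Subtype.val = ⊥ ∧ i + 2 ≤ Module.finrank K X.1) →
      R.syz i X ⊓ ⨆ H ∈ B, R.filAug i (meet X H) ≤ ⨆ H ∈ B, R.syz i (meet X H) := by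
  induction i with
  -- In degree zero `filAug` and `syz` coincide.
  | zero => exact fun X B _ _ => inf_le_right
  | succ i ih => exact hR.syz_succ_inf_iSup_le i (hR.syz_le_map_fil_of hA hess i ih) ih

theorem map_fil_eq (hA : IsHyperplaneArrangement A) (hess : IsEssential A) (i : ℕ)
    (X : intersectionPoset A) : (R.fil i X).map (R.φ i) = R.syz i X :=
  le_antisymm (hR.map_fil_le i X)
    (hR.syz_le_map_fil_of hA hess i (hR.syz_inf_iSup_le hA hess i) X)

/-- `F i` is spanned by finitely many summands, each embedded by `φ i` in the previous term. -/
theorem finite_augTerm (i : ℕ) : FiniteDimensional K (augTerm V R.F i) := by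
  induction i with
  | zero => exact inferInstanceAs (FiniteDimensional K V)
  | succ i ih =>
    have h : ∀ X : {X : intersectionPoset A // Module.finrank K X.1 = i + 1},
        FiniteDimensional K (R.fil i X.1) := fun X =>
      FiniteDimensional.of_injective ((R.φ i).domRestrict (R.fil i X.1)) fun x y hxy =>
        Subtype.ext ((hR.bijOn i X.1 X.2).injOn x.2 y.2 hxy)
    have h' := Submodule.finite_iSup fun X :
      {X : intersectionPoset A // Module.finrank K X.1 = i + 1} => R.fil i X.1
    rw [hR.iSup_eq_top] at h'
    exact Module.finite_def.2 ((Submodule.fg_top _).1 (Module.finite_def.1 h'))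

/-- Bases of the summands `F i ^ X`, `dim X = i + 1`, collect to an adapted basis. -/
theorem isCoordinateArrangement (i : ℕ) : IsCoordinateArrangement (R.fil i) where
  exists_basis := by
    classical
    have := hR.finite_augTerm (i + 1)
    change FiniteDimensional K (R.F i) at this
    have hint := DirectSum.isInternal_submodule_of_iSupIndep_of_iSup_eq_top (hR.indep i)
      (hR.iSup_eq_top i)
    let v := fun X : {X : intersectionPoset A // Module.finrank K X.1 = i + 1} =>
      Module.finBasis K (R.fil i X.1)
    let b := hint.collectedBasis v
    let e := Fintype.equivFin
      (Σ X : {X : intersectionPoset A // Module.finrank K X.1 = i + 1},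
        Fin (Module.finrank K (R.fil i X.1)))
    refine ⟨_, b.reindex e, fun Y => ⟨{j | (e.symm j).1.1 ≤ Y}, ?_⟩⟩
    refine le_antisymm ?_ (Submodule.span_le.2 ?_)
    · rw [hR.fil_eq i Y]
      refine iSup₂_le fun X hX => ?_
      have hspan : R.fil i X.1 = Submodule.span K (Set.range fun j => (v X j : R.F i)) := by
        rw [Set.range_comp' Subtype.val, ← Submodule.coe_subtype, Submodule.span_image,
          (v X).span_eq, Submodule.map_top, Submodule.range_subtype]
      rw [hspan]
      refine Submodule.span_mono ?_
      rintro _ ⟨j, rfl⟩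
      refine ⟨e ⟨X, j⟩, by simpa using hX, ?_⟩
      rw [Module.Basis.reindex_apply, e.symm_apply_apply]
      exact congrFun (hint.collectedBasis_coe v) ⟨X, j⟩
    · rintro _ ⟨j, hj, rfl⟩
      rw [Module.Basis.reindex_apply]
      exact hR.fil_mono i hj (hint.collectedBasis_mem v _)
  top X hX := by
    rw [eq_top_iff, ← hR.iSup_eq_top i]
    exact iSup_le fun Z => hR.fil_mono i (show Z.1.1 ≤ X.1 from hX ▸ le_top)
  inter X Y Z h := by
    rw [← hR.fil_meet]
    congr 1
    exact Subtype.ext h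

theorem isResolution (hA : IsHyperplaneArrangement A) (hess : IsEssential A) :
    R.IsResolution :=
  ⟨hR.isCoordinateArrangement, hR.map_fil_eq hA hess⟩

/-- A basis vector of `F i` lies in some `F i ^ X` with `dim X = i + 1`, where `F (i + 1) ^ X`
vanishes; so no two basis vectors share a degree. -/
theorem isMinimal : R.IsMinimal := by
  intro i m n b c hb hc j l h
  obtain ⟨X, hX, hl⟩ := hR.exists_mem_fil hc l
  have hj := (h X).2 hl
  rw [hR.fil_eq_bot (i + 1) X hX.le] at hj
  exact absurd ((Submodule.mem_bot K).1 hj) (b.ne_zero j)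

theorem subsingleton (i : ℕ) (hi : Module.finrank K V ≤ i) : Subsingleton (R.F i) := by
  have h := hR.iSup_eq_top i
  have h' : IsEmpty {X : intersectionPoset A // Module.finrank K X.1 = i + 1} :=
    ⟨fun X => by have := Submodule.finrank_le X.1.1; have := X.2; omega⟩
  rw [iSup_of_empty] at h
  exact (Submodule.subsingleton_iff K).1 (subsingleton_of_bot_eq_top h)

end IsLinear
end ArrangementSequence
end HyperplaneResolution

namespace HyperplaneResolution

/-! ### Möbius inversion and the beta invariant. -/

section Moebius

variable {K : Type u} [Field K] {V : Type v} [AddCommGroup V] [Module K V]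

theorem mobius_eq_zero_of_not_le {P : Finset (Submodule K V)} {X Y : P} (h : ¬ X ≤ Y) :
    mobius P X Y = 0 := by
  classical
  let _ : LocallyFiniteOrder P := Fintype.toLocallyFiniteOrder
  exact IncidenceAlgebra.apply_eq_zero_of_not_le h _

open scoped Classical in
theorem sum_mobius {P : Finset (Submodule K V)} (X Z : P) :
    ∑ Y : P, (if X ≤ Y then mobius P Y Z else 0) = if X = Z then 1 else 0 := by
  let _ : LocallyFiniteOrder P := Fintype.toLocallyFiniteOrder
  have h := IncidenceAlgebra.sum_Icc_mu_left (𝕜 := ℤ) X Z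
  rw [← h, ← Finset.sum_filter]
  symm
  refine Finset.sum_subset (fun Y hY => by simpa using (Finset.mem_Icc.1 hY).1) ?_
  intro Y hY hY'
  refine mobius_eq_zero_of_not_le fun hle => hY' (Finset.mem_Icc.2 ⟨?_, hle⟩)
  simpa using hY

open scoped Classical in
/-- Möbius inversion. -/
theorem sum_mul_mobius {P : Finset (Submodule K V)} (f : Submodule K V → ℤ) (h : P → ℤ)
    (hf : ∀ W : P, h W = ∑ Y ∈ P with Y ≤ W.1, f Y) (X : P) :
    ∑ W : P, h W * mobius P W X = f X.1 := by
  have h1 : ∀ W : P, h W * mobius P W X =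
      ∑ Y : P, f Y.1 * if Y ≤ W then mobius P W X else 0 := by
    intro W
    rw [hf, Finset.sum_filter, ← Finset.sum_coe_sort, Finset.sum_mul]
    refine Finset.sum_congr rfl fun Y _ => ?_
    simp only [← Subtype.coe_le_coe]
    split_ifs <;> simp
  rw [Finset.sum_congr rfl fun W _ => h1 W, Finset.sum_comm]
  simp_rw [← Finset.mul_sum, sum_mobius]
  simp

/-- As `k < dim X`, the only element of dimension `dim X` in the truncated poset is `X`, so the
Whitney numbers reduce to values `μ(Y, X)`. -/
theorem betaTrunc_eq [FiniteDimensional K V] {A : Finset (Submodule K V)} {k : ℕ}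
    {X : intersectionPoset A} (hk : k < Module.finrank K X.1) (hX : X.1 ∈ truncatedPoset A k X) :
    betaTrunc A k X = (-1) ^ k * ∑ Y : truncatedPoset A k X,
      (Module.finrank K Y.1 : ℤ) * mobius (truncatedPoset A k X) Y ⟨X.1, hX⟩ := by
  classical
  have hP : ∀ Y : truncatedPoset A k X, Y.1 ≤ X.1 ∧ (Module.finrank K Y.1 ≤ k ∨ Y.1 = X.1) :=
    fun Y => by have := Y.2; simp only [truncatedPoset, Finset.mem_filter] at this; exact this.2
  unfold betaTrunc whitneyNumber
  congr 1
  simp_rw [Finset.mul_sum]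
  rw [Finset.sum_comm]
  refine Finset.sum_congr rfl fun Y _ => ?_
  rw [Finset.sum_eq_single (Module.finrank K Y.1)]
  · rw [Finset.sum_eq_single ⟨X.1, hX⟩]
    · rw [if_pos ⟨(hP Y).1, rfl, rfl⟩]
    · intro Z _ hZ
      rw [if_neg, mul_zero]
      rintro ⟨-, -, h⟩
      rcases (hP Z).2 with h' | h'
      · omega
      · exact hZ (Subtype.ext h')
    · simp
  · intro d _ hd
    refine Finset.sum_eq_zero fun Z _ => ?_
    rw [if_neg fun h => hd h.2.1.symm, mul_zero]
  · intro h
    have := Submodule.finrank_mono (hP Y).1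
    exact absurd (Finset.mem_range.2 (by omega)) h

end Moebius

/-! ### Dimensions of the syzygy spaces. -/

namespace ArrangementSequence

variable {K : Type u} [Field K] {V : Type v} [AddCommGroup V] [Module K V]
  {A : Finset (Submodule K V)} {R : ArrangementSequence A}

open scoped Classical in
/-- The signed dimension of the syzygy space `X ^ (dim X - 1)`. -/
noncomputable def signedDim (R : ArrangementSequence A) (Y : Submodule K V) : ℤ :=
  if h : Y ∈ intersectionPoset A then
    (-1) ^ (Module.finrank K Y - 1) * Module.finrank K (R.syz (Module.finrank K Y - 1) ⟨Y, h⟩)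
  else 0

theorem signedDim_of_finrank_eq {X : intersectionPoset A} {k : ℕ}
    (h : Module.finrank K X.1 = k + 1) :
    R.signedDim X.1 = (-1) ^ k * Module.finrank K (R.syz k X) := by
  rw [signedDim, dif_pos X.2, h]
  rfl

/-- Truncated subtraction gives degree `0`, and `Y^0 = Y` has dimension zero. -/
theorem signedDim_of_finrank_eq_zero {Y : Submodule K V} (h : Module.finrank K Y = 0) :
    R.signedDim Y = 0 := by
  unfold signedDim
  split_ifs with hY
  · rw [h]
    change (-1) ^ 0 * ((Module.finrank K Y : ℕ) : ℤ) = 0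
    rw [h]
    simp
  · rfl

namespace IsLinear

variable (hR : R.IsLinear) [FiniteDimensional K V]
include hR

theorem finrank_syz_add (hA : IsHyperplaneArrangement A) (hess : IsEssential A) (k : ℕ)
    (X : intersectionPoset A) :
    Module.finrank K (R.syz k X) + Module.finrank K (R.syz (k + 1) X) =
      Module.finrank K (R.fil k X) := by
  have := hR.finite_augTerm (k + 1)
  change FiniteDimensional K (R.F k) at this
  have h := LinearMap.finrank_range_add_finrank_ker ((R.φ k).domRestrict (R.fil k X))
  rw [← h, LinearMap.range_domRestrict, hR.map_fil_eq hA hess,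
    ← Submodule.finrank_map_subtype_eq (R.fil k X) (LinearMap.ker _), LinearMap.ker_domRestrict,
    Submodule.map_comap_subtype]
  rfl

theorem finrank_fil_eq (hA : IsHyperplaneArrangement A) (hess : IsEssential A) {i : ℕ}
    {X : intersectionPoset A} (h : Module.finrank K X.1 = i + 1) :
    Module.finrank K (R.fil i X) = Module.finrank K (R.syz i X) := by
  rw [← hR.finrank_syz_add hA hess, hR.syz_eq_bot (i + 1) X h.le, finrank_bot, add_zero]

open scoped Classical in
theorem finrank_fil (hA : IsHyperplaneArrangement A) (hess : IsEssential A) (k : ℕ)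
    (X : intersectionPoset A) :
    (-1) ^ k * (Module.finrank K (R.fil k X) : ℤ) =
      ∑ Y ∈ intersectionPoset A with Y ≤ X.1 ∧ Module.finrank K Y = k + 1, R.signedDim Y := by
  have := hR.finite_augTerm (k + 1)
  change FiniteDimensional K (R.F k) at this
  have h := finrank_biSup_of_iSupIndep (hR.indep k) {Z | Z.1 ≤ X}
  have h' : R.fil k X = ⨆ Z ∈ ({Z | Z.1 ≤ X} : Finset {Z : intersectionPoset A //
      Module.finrank K Z.1 = k + 1}), R.fil k Z.1 := by
    rw [hR.fil_eq k X]
    simp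
  rw [h', h, Nat.cast_sum, Finset.mul_sum]
  refine Finset.sum_bij (fun Z _ => Z.1.1) ?_ ?_ ?_ ?_
  · intro Z hZ
    simp only [Finset.mem_filter, Finset.mem_univ, true_and] at hZ
    exact Finset.mem_filter.2 ⟨Z.1.2, hZ, Z.2⟩
  · intro Z _ Z' _ h
    exact Subtype.ext (Subtype.ext h)
  · intro Y hY
    obtain ⟨h1, h2, h3⟩ := Finset.mem_filter.1 hY
    exact ⟨⟨⟨Y, h1⟩, h3⟩, Finset.mem_filter.2 ⟨Finset.mem_univ _, h2⟩, rfl⟩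
  · intro Z _
    rw [signedDim_of_finrank_eq Z.2, hR.finrank_fil_eq hA hess Z.2]

open scoped Classical in
/-- The alternating sum formula for the dimensions of the syzygy spaces. -/
theorem finrank_syz (hA : IsHyperplaneArrangement A) (hess : IsEssential A) (k : ℕ)
    (X : intersectionPoset A) :
    (-1) ^ k * (Module.finrank K (R.syz k X) : ℤ) +
      ∑ Y ∈ intersectionPoset A with Y ≤ X.1 ∧ Module.finrank K Y ≤ k, R.signedDim Y =
      Module.finrank K X.1 := by
  induction k with
  | zero =>
    rw [Finset.sum_eq_zero fun Y hY =>
      signedDim_of_finrank_eq_zero (Nat.le_zero.1 (Finset.mem_filter.1 hY).2.2)]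
    rw [pow_zero, one_mul, add_zero]
    rfl
  | succ k ih =>
    -- The new terms, of dimension `k + 1`, add `(-1)^k dim F k ^ X = (-1)^k (dim X^k + dim
    -- X^(k+1))`, so the sum telescopes.
    have h : ({Y ∈ intersectionPoset A | Y ≤ X.1 ∧ Module.finrank K Y ≤ k + 1} : Finset _) =
        {Y ∈ intersectionPoset A | Y ≤ X.1 ∧ Module.finrank K Y ≤ k} ∪
        {Y ∈ intersectionPoset A | Y ≤ X.1 ∧ Module.finrank K Y = k + 1} := by
      rw [← Finset.filter_or]
      refine Finset.filter_congr fun Y _ => ?_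
      rw [← and_or_left, Nat.le_succ_iff]
    have hd : Disjoint
        ({Y ∈ intersectionPoset A | Y ≤ X.1 ∧ Module.finrank K Y ≤ k} : Finset _)
        {Y ∈ intersectionPoset A | Y ≤ X.1 ∧ Module.finrank K Y = k + 1} :=
      Finset.disjoint_filter.2 fun Y _ h1 h2 => by omega
    rw [h, Finset.sum_union hd, ← hR.finrank_fil hA hess k X, ← hR.finrank_syz_add hA hess k X,
      ← ih]
    push_cast
    ring

/-- The dimensions of the syzygy spaces are the beta invariants. -/
theorem finrank_syz_eq_betaTrunc (hA : IsHyperplaneArrangement A) (hess : IsEssential A) (k : ℕ)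
    (X : intersectionPoset A) (hk : k < Module.finrank K X.1) :
    (Module.finrank K (R.syz k X) : ℤ) = betaTrunc A k X := by
  classical
  have hmem : ∀ Y, Y ∈ truncatedPoset A k X ↔
      Y ∈ intersectionPoset A ∧ Y ≤ X.1 ∧ (Module.finrank K Y ≤ k ∨ Y = X.1) := by
    simp [truncatedPoset]
  have hX : X.1 ∈ truncatedPoset A k X := (hmem _).2 ⟨X.2, le_rfl, Or.inr rfl⟩
  -- The inverted function is `signedDim` below `X` and the signed dimension of `X^k` at `X`; its
  -- sums over lower intervals are to be the dimensions.
  rw [betaTrunc_eq hk hX, sum_mul_mobius (fun Y => if Y = X.1 then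
    (-1) ^ k * (Module.finrank K (R.syz k X) : ℤ) else R.signedDim Y)
    (fun Y => (Module.finrank K Y.1 : ℤ)) _ ⟨X.1, hX⟩]
  · rw [if_pos rfl, ← mul_assoc, ← mul_pow]
    simp
  rintro ⟨W, hW⟩
  obtain ⟨hWA, hWX, hWk⟩ := (hmem W).1 hW
  by_cases h : W = X.1
  · subst h
    have hins : ({Y ∈ truncatedPoset A k X | Y ≤ X.1} : Finset _) =
        insert X.1 {Y ∈ intersectionPoset A | Y ≤ X.1 ∧ Module.finrank K Y ≤ k} := by
      ext Y
      simp only [Finset.mem_filter, hmem, Finset.mem_insert]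
      constructor
      · tauto
      · rintro (rfl | h)
        · exact ⟨⟨X.2, le_rfl, Or.inr rfl⟩, le_rfl⟩
        · tauto
    rw [hins, Finset.sum_insert (by simp [hk]), if_pos rfl, ← hR.finrank_syz hA hess k X]
    congr 1
    refine Finset.sum_congr rfl fun Y hY => ?_
    rw [if_neg]
    rintro rfl
    have := (Finset.mem_filter.1 hY).2.2
    omega
  · have hWk := hWk.resolve_right h
    -- For `W ≠ X` the formula is taken in degree `dim W`, where the syzygy term vanishes.
    have hs := hR.finrank_syz hA hess (Module.finrank K W) ⟨W, hWA⟩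
    rw [hR.syz_eq_bot _ ⟨W, hWA⟩ le_rfl, finrank_bot, Nat.cast_zero, mul_zero, zero_add] at hs
    change _ = ((Module.finrank K W : ℕ) : ℤ) at hs
    change ((Module.finrank K W : ℕ) : ℤ) = _
    rw [← hs]
    refine Finset.sum_congr ?_ ?_
    · ext Y
      simp only [Finset.mem_filter, hmem]
      constructor
      · rintro ⟨h1, h2, h3⟩
        exact ⟨⟨h1, h2.trans hWX, Or.inl (h3.trans hWk)⟩, h2⟩
      · rintro ⟨⟨h1, -⟩, h2⟩
        exact ⟨h1, h2, Submodule.finrank_mono h2⟩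
    · intro Y hY
      rw [if_neg]
      rintro rfl
      exact h (le_antisymm hWX (Finset.mem_filter.1 hY).2)

end IsLinear
end ArrangementSequence
end HyperplaneResolution

theorem mainTheorem4 {K : Type u} [Field K] {V : Type v} [AddCommGroup V] [Module K V]
    [FiniteDimensional K V] (A : Finset (Submodule K V)) (r : ℕ)
    (hA : HyperplaneResolution.IsHyperplaneArrangement A)
    (hess : HyperplaneResolution.IsEssential A)
    (hr : HyperplaneResolution.arrangementRank A = r) :
    ∃ R : HyperplaneResolution.ArrangementSequence A,
      -- a minimal resolution by coordinate arrangements, of length at most `r - 1`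
      R.IsResolution ∧ R.IsMinimal ∧ (∀ i, r ≤ i → Subsingleton (R.F i)) ∧
      -- `F_i^Y` is the direct sum of the `F_i^X` with `X ≤ Y` and `dim X = i + 1`
      (∀ (i : ℕ) (Y : HyperplaneResolution.intersectionPoset A),
        iSupIndep (fun X : {X : HyperplaneResolution.intersectionPoset A //
          X ≤ Y ∧ Module.finrank K X.1 = i + 1} => R.fil i X.1) ∧
        R.fil i Y = ⨆ X : {X : HyperplaneResolution.intersectionPoset A //
          X ≤ Y ∧ Module.finrank K X.1 = i + 1}, R.fil i X.1) ∧
      -- the differential restricts to isomorphisms `F_i^X ≅ X^i` if `dim X = i + 1`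
      (∀ (i : ℕ) (X : HyperplaneResolution.intersectionPoset A),
        Module.finrank K X.1 = i + 1 →
          Set.BijOn (R.φ i) (R.fil i X : Set (R.F i))
            (R.syz i X : Set (HyperplaneResolution.augTerm V R.F i))) ∧
      -- dimensions of the syzygy spaces
      (∀ (k : ℕ) (X : HyperplaneResolution.intersectionPoset A),
        k < Module.finrank K X.1 →
          (Module.finrank K (R.syz k X) : ℤ) = HyperplaneResolution.betaTrunc A k X) ∧
      (∀ (k : ℕ) (X : HyperplaneResolution.intersectionPoset A),
        Module.finrank K X.1 ≤ k → R.syz k X = ⊥) ∧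
      (∀ (i : ℕ) (X : HyperplaneResolution.intersectionPoset A),
        Module.finrank K X.1 = i + 1 →
          (Module.finrank K (R.syz i X) : ℤ) = HyperplaneResolution.betaInvariant A X ∧
          (Module.finrank K (R.fil i X) : ℤ) = HyperplaneResolution.betaInvariant A X) := by
  obtain ⟨R, hR⟩ : ∃ R : HyperplaneResolution.ArrangementSequence A, R.IsLinear :=
    ⟨_, HyperplaneResolution.linearSequence_isLinear⟩
  refine ⟨R, hR.isResolution hA hess, hR.isMinimal, ?_, ?_,
    hR.bijOn, hR.finrank_syz_eq_betaTrunc hA hess, hR.syz_eq_bot, ?_⟩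
  · intro i hi
    refine hR.subsingleton i ?_
    rw [← hr, HyperplaneResolution.arrangementRank,
      show HyperplaneResolution.center A = ⊥ from hess, Submodule.finrank_quotient,
      finrank_bot, Nat.sub_zero] at hi
    exact hi
  · refine fun i Y => ⟨?_, ?_⟩
    · exact (hR.indep i).comp (f := fun X : {X : HyperplaneResolution.intersectionPoset A //
        X ≤ Y ∧ Module.finrank K X.1 = i + 1} => ⟨X.1, X.2.2⟩)
        fun X X' h => Subtype.ext (congrArg (fun Z => Z.1) h)
    · rw [hR.fil_eq i Y]
      refine le_antisymm (iSup₂_le fun X hX => ?_) (iSup_le fun X => ?_)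
      · exact le_iSup_of_le ⟨X.1, hX, X.2⟩ le_rfl
      · exact le_iSup₂_of_le ⟨X.1, X.2.2⟩ X.2.1 le_rfl
  · intro i X hX
    have h : (Module.finrank K (R.syz i X) : ℤ) =
        HyperplaneResolution.betaInvariant A X := by
      rw [HyperplaneResolution.betaInvariant, hX, Nat.add_sub_cancel]
      exact hR.finrank_syz_eq_betaTrunc hA hess i X (by omega)
    exact ⟨h, by rw [hR.finrank_fil_eq hA hess hX, h]⟩
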